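/- Let $a,b$ be integers with $0<a<b$. For a field $K$ of characteristic zero and an integer $j\ge 1$, let $I_j\subset R=K[x_0,x_1,x_2]$ be the defining ideal of the monomial curve $(t^j,t^{j+a},t^{j+b})$, i.e. the kernel of the $K$-algebra homomorphism $R\to K[t]$ with $x_0\mapsto t^{j}$, $x_1\mapsto t^{j+a}$, $x_2\mapsto t^{j+b}$. For $i\ge 0$ let $\beta_i(I_j)=\dim_K \operatorname{Tor}_i^R\bigl(R/(x_0,x_1,x_2),\,I_j\bigr)$ be the $i$-th Betti number of $I_j$. Then the Betti numbers of $I_j$ are eventually periodic in $j$ with period $b$: there is an integer $N\ge 1$, depending only on $a$ and $b$, such that $$\beta_i(I_{j+b})=\beta_i(I_j)\qquad\text{for all } j\ge N,\ \text{all } i\ge 0 \text{ and all fields } K \text{ of characteristic zero.}$$ -/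

import Mathlib

universe u

noncomputable section

/-- The defining ideal, in `K[x₀, …, x_{n-1}]`, of the affine monomial curve parametrized by
`t ↦ (t ^ e₀, …, t ^ e_{n-1})`: the kernel of the `K`-algebra map `xᵢ ↦ t ^ eᵢ` to `K[t]`. -/
def monomialCurveIdeal (K : Type u) [Field K] {n : ℕ} (e : Fin n → ℕ) :
    Ideal (MvPolynomial (Fin n) K) :=
  RingHom.ker (MvPolynomial.aeval (fun i => (Polynomial.X : Polynomial K) ^ e i) :
    MvPolynomial (Fin n) K →ₐ[K] Polynomial K)

/-- The residue field `R / (x₀, …, x_{n-1})` of `R = K[x₀, …, x_{n-1}]` at the origin,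
as an `R`-module. -/
abbrev residueModule (K : Type u) [Field K] (n : ℕ) : Type u :=
  MvPolynomial (Fin n) K ⧸
    Ideal.span (Set.range (MvPolynomial.X : Fin n → MvPolynomial (Fin n) K))

/-- The `i`-th (total) Betti number of a module `M` over `R = K[x₀, …, x_{n-1}]`: the dimension
over `K` of `Tor_i^R (R / (x₀, …, x_{n-1}), M)`. -/
def bettiNumber (K : Type u) [Field K] (n i : ℕ) (M : Type u) [AddCommGroup M]
    [Module (MvPolynomial (Fin n) K) M] : ℕ :=
  Module.finrank K
    ((ModuleCat.restrictScalars (MvPolynomial.C : K →+* MvPolynomial (Fin n) K)).obj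
      (((CategoryTheory.Tor (ModuleCat.{u} (MvPolynomial (Fin n) K)) i).obj
        (ModuleCat.of _ (residueModule K n))).obj (ModuleCat.of _ M)))

end

/-! Write `a = e s γ`, `b = e s c`, `j = e h` with `c = α + γ`, where `γ, c` and `s, h` are coprime
pairs. For large `j` there is an expression `h = p γ + q c` with `p < c` and `q ≥ α`. The ideal is
then generated by the 2 × 2 minors of a matrix with monomial entries (`monomialCurveIdeal_eq_span`).
One minor is the homogeneous binomial `x₁ ^ c - x₀ ^ α x₂ ^ γ`. It is prime and does not divide the
minor `x₁ ^ p x₂ ^ q - x₀ ^ (s + p + q)`, so Hilbert–Burch gives a resolution. If `p > 0`, all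
matrix entries are nonunits and the ranks are 3, 2. If `p = 0`, one generator is redundant and a
Koszul resolution has ranks 2, 1. Replacing `j` by `j + b` replaces `q` by `q + s` and fixes `p`, so
the ranks do not change. Minimality turns ranks into Betti numbers (`bettiNumber_eq`). -/

open CategoryTheory

/-! ### Betti numbers from minimal free resolutions -/

/-- A minimal free resolution, with ranks `r`, of a module `M` over `K[x₀, …, x_{n-1}]`: all the
entries of the differentials lie in the ideal `(x₀, …, x_{n-1})`. -/
structure MinimalFreeResolution (K : Type u) [Field K] (n : ℕ) (r : ℕ → ℕ) (M : Type u)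
    [AddCommGroup M] [Module (MvPolynomial (Fin n) K) M] where
  /-- the differentials -/
  d : ∀ i, (Fin (r (i + 1)) → MvPolynomial (Fin n) K) →ₗ[MvPolynomial (Fin n) K]
    (Fin (r i) → MvPolynomial (Fin n) K)
  /-- the augmentation -/
  aug : (Fin (r 0) → MvPolynomial (Fin n) K) →ₗ[MvPolynomial (Fin n) K] M
  exact_d : ∀ i, Function.Exact (d (i + 1)) (d i)
  exact_aug : Function.Exact (d 0) aug
  surjective_aug : Function.Surjective aug
  minimal : ∀ i v k, d i v k ∈
    Ideal.span (Set.range (MvPolynomial.X : Fin n → MvPolynomial (Fin n) K))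

namespace MinimalFreeResolution

variable {K : Type u} [Field K] {n : ℕ} {r : ℕ → ℕ} {M M' : Type u}
  [AddCommGroup M] [Module (MvPolynomial (Fin n) K) M]
  [AddCommGroup M'] [Module (MvPolynomial (Fin n) K) M']

/-- The chain complex underlying a minimal free resolution. -/
noncomputable def complex (F : MinimalFreeResolution K n r M) :
    ChainComplex (ModuleCat.{u} (MvPolynomial (Fin n) K)) ℕ :=
  ChainComplex.of (fun i => ModuleCat.of _ (Fin (r i) → MvPolynomial (Fin n) K))
    (fun i => ModuleCat.ofHom (F.d i)) (fun i => by
      rw [← ModuleCat.ofHom_comp, (F.exact_d i).linearMap_comp_eq_zero]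
      rfl)

lemma complex_d (F : MinimalFreeResolution K n r M) (i : ℕ) :
    F.complex.d (i + 1) i = ModuleCat.ofHom (F.d i) :=
  ChainComplex.of_d (fun i => ModuleCat.of _ (Fin (r i) → MvPolynomial (Fin n) K))
    (fun i => ModuleCat.ofHom (F.d i)) i

lemma complex_exactAt_succ (F : MinimalFreeResolution K n r M) (i : ℕ) :
    F.complex.ExactAt (i + 1) := by
  rw [HomologicalComplex.exactAt_iff' _ (i + 1 + 1) (i + 1) i (by simp) (by simp),
    ShortComplex.ShortExact.moduleCat_exact_iff_function_exact]
  change Function.Exact (F.complex.d (i + 1 + 1) (i + 1)) (F.complex.d (i + 1) i)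
  rw [complex_d, complex_d]
  exact F.exact_d i

/-- The augmentation, as a morphism in the category of modules. -/
noncomputable def augHom (F : MinimalFreeResolution K n r M) :
    F.complex.X 0 ⟶ ModuleCat.of (MvPolynomial (Fin n) K) M :=
  ModuleCat.ofHom F.aug

lemma complex_d_comp_augHom (F : MinimalFreeResolution K n r M) :
    F.complex.d 1 0 ≫ F.augHom = 0 := by
  rw [complex_d]
  exact (ModuleCat.ofHom_comp _ _).symm.trans
    (congrArg ModuleCat.ofHom F.exact_aug.linearMap_comp_eq_zero)

/-- The map `g` is kept general because the quasi-isomorphism criterion presents the augmentation as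
a component of `π`, equal to `augHom` only propositionally. -/
lemma exact_and_epi_of_eq_augHom (F : MinimalFreeResolution K n r M)
    {g : F.complex.X 0 ⟶ ModuleCat.of (MvPolynomial (Fin n) K) M} (hg : g = F.augHom)
    (w : F.complex.d 1 0 ≫ g = 0) : (ShortComplex.mk _ _ w).Exact ∧ Epi g := by
  subst hg
  refine ⟨?_, (ModuleCat.epi_iff_surjective _).2 F.surjective_aug⟩
  rw [ShortComplex.ShortExact.moduleCat_exact_iff_function_exact]
  change Function.Exact (F.complex.d 1 0) F.augHom
  rw [complex_d]
  exact F.exact_aug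

/-- A minimal free resolution is a projective resolution. -/
noncomputable def projectiveResolution (F : MinimalFreeResolution K n r M) :
    ProjectiveResolution (ModuleCat.of (MvPolynomial (Fin n) K) M) where
  complex := F.complex
  projective i := inferInstanceAs
    (Projective (ModuleCat.of _ (Fin (r i) → MvPolynomial (Fin n) K)))
  π := (ChainComplex.toSingle₀Equiv _ _).symm ⟨F.augHom, F.complex_d_comp_augHom⟩
  quasiIso := ⟨fun i => by
    cases i
    · rw [ChainComplex.quasiIsoAt₀_iff, ShortComplex.quasiIso_iff_of_zeros']
      · exact F.exact_and_epi_of_eq_augHom (ChainComplex.toSingle₀Equiv_symm_apply_f_zero _ _) _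
      all_goals rfl
    · rw [quasiIsoAt_iff_exactAt']
      · apply complex_exactAt_succ
      · apply ChainComplex.exactAt_succ_single_obj⟩

open MonoidalCategory in
-- By minimality the entries of the differential annihilate the residue module.
lemma whiskerLeft_complex_d (F : MinimalFreeResolution K n r M) (i j : ℕ) :
    (((tensoringLeft (ModuleCat.{u} (MvPolynomial (Fin n) K))).obj
      (ModuleCat.of _ (residueModule K n))).mapHomologicalComplex _ |>.obj F.complex).d i j = 0 := by
  by_cases hij : i = j + 1
  · subst hij
    rw [Functor.mapHomologicalComplex_obj_d, complex_d]
    refine ModuleCat.hom_ext (TensorProduct.ext' fun x v => ?_)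
    change x ⊗ₜ[MvPolynomial (Fin n) K] F.d j v = 0
    rw [pi_eq_sum_univ' (F.d j v), TensorProduct.tmul_sum]
    refine Finset.sum_eq_zero fun k _ => ?_
    rw [TensorProduct.tmul_smul, TensorProduct.smul_tmul']
    obtain ⟨y, rfl⟩ := Ideal.Quotient.mk_surjective x
    have hx : F.d j v k • (Ideal.Quotient.mk _ y : residueModule K n) = 0 :=
      Ideal.Quotient.eq_zero_iff_mem.2 (Ideal.mul_mem_right _ _ (F.minimal j v k))
    rw [hx, TensorProduct.zero_tmul]
  · exact HomologicalComplex.shape _ _ _ (by simpa [eq_comm] using hij)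

/-- After reduction modulo `(x₀, …, x_{n-1})`, two minimal free resolutions with the same ranks
become isomorphic complexes. -/
noncomputable def residueIso (F : MinimalFreeResolution K n r M)
    (F' : MinimalFreeResolution K n r M') :
    (((MonoidalCategory.tensoringLeft (ModuleCat.{u} (MvPolynomial (Fin n) K))).obj
      (ModuleCat.of _ (residueModule K n))).mapHomologicalComplex
        (ComplexShape.down ℕ)).obj F.complex ≅
    (((MonoidalCategory.tensoringLeft (ModuleCat.{u} (MvPolynomial (Fin n) K))).obj
      (ModuleCat.of _ (residueModule K n))).mapHomologicalComplex
        (ComplexShape.down ℕ)).obj F'.complex :=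
  HomologicalComplex.Hom.isoOfComponents (fun i => Iso.refl _) fun i j _ => by
    rw [whiskerLeft_complex_d, whiskerLeft_complex_d, Limits.comp_zero, Limits.zero_comp]

/-- The modules `Tor_i (R / (x₀, …, x_{n-1}), M)` only depend on the ranks of a minimal free
resolution of `M`. -/
noncomputable def torIso (F : MinimalFreeResolution K n r M)
    (F' : MinimalFreeResolution K n r M') (i : ℕ) :
    ((Tor (ModuleCat.{u} (MvPolynomial (Fin n) K)) i).obj
      (ModuleCat.of _ (residueModule K n))).obj (ModuleCat.of _ M) ≅
    ((Tor (ModuleCat.{u} (MvPolynomial (Fin n) K)) i).obj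
      (ModuleCat.of _ (residueModule K n))).obj (ModuleCat.of _ M') :=
  F.projectiveResolution.isoLeftDerivedObj
      ((MonoidalCategory.tensoringLeft _).obj (ModuleCat.of _ (residueModule K n))) i ≪≫
    (HomologicalComplex.homologyFunctor _ _ i).mapIso (F.residueIso F') ≪≫
    (F'.projectiveResolution.isoLeftDerivedObj
      ((MonoidalCategory.tensoringLeft _).obj (ModuleCat.of _ (residueModule K n))) i).symm

lemma bettiNumber_eq (F : MinimalFreeResolution K n r M)
    (F' : MinimalFreeResolution K n r M') (i : ℕ) : bettiNumber K n i M = bettiNumber K n i M' := by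
  unfold bettiNumber
  have e := ((ModuleCat.restrictScalars (MvPolynomial.C : K →+* MvPolynomial (Fin n) K)).mapIso
    (F.torIso F' i)).toLinearEquiv
  exact e.finrank_eq

end MinimalFreeResolution

/-! ### Resolutions of length one: Koszul and Hilbert–Burch -/

open MvPolynomial

/-- The ranks of a two-step free resolution. -/
def twoStepRank (m n : ℕ) : ℕ → ℕ
  | 0 => m
  | 1 => n
  | _ + 2 => 0

/-- The minimal free resolution of length one of an ideal given by generators `f` and a basis `z`
of their module of syzygies. -/
noncomputable def MinimalFreeResolution.ofSyzygies {K : Type u} [Field K] {k m n : ℕ}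
    {I : Ideal (MvPolynomial (Fin k) K)} (f : Fin m → MvPolynomial (Fin k) K)
    (z : Fin n → Fin m → MvPolynomial (Fin k) K) (hI : I = Ideal.span (Set.range f))
    (hz : LinearIndependent (MvPolynomial (Fin k) K) z)
    (hexact : ∀ u, ∑ i, u i * f i = 0 ↔
      u ∈ Submodule.span (MvPolynomial (Fin k) K) (Set.range z))
    (hmin : ∀ i j, z i j ∈ Ideal.span (Set.range (X : Fin k → MvPolynomial (Fin k) K))) :
    MinimalFreeResolution K k (twoStepRank m n) I where
  d
    | 0 => Fintype.linearCombination (MvPolynomial (Fin k) K) z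
    | _ + 1 => 0
  aug := (Fintype.linearCombination (MvPolynomial (Fin k) K) f).codRestrict I fun u => by
    rw [hI, Fintype.linearCombination_apply]
    exact Ideal.sum_mem _ fun i _ => Ideal.mul_mem_left _ _ (Ideal.subset_span ⟨i, rfl⟩)
  exact_d
    | 0 =>
      have h : Function.Exact (0 : (Fin 0 → MvPolynomial (Fin k) K) →ₗ[MvPolynomial (Fin k) K] _)
          (Fintype.linearCombination (MvPolynomial (Fin k) K) z) :=
        (LinearMap.exact_zero_iff_injective _ _).2 hz.fintypeLinearCombination_injective
      h
    | _ + 1 => fun v => ⟨fun _ => ⟨0, Subsingleton.elim (α := Fin 0 → _) _ _⟩, fun _ => rfl⟩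
  exact_aug :=
    have h (u : Fin m → MvPolynomial (Fin k) K) : ∑ i, u i * f i = 0 ↔
        u ∈ Set.range (Fintype.linearCombination (MvPolynomial (Fin k) K) z) := by
      rw [← LinearMap.coe_range, SetLike.mem_coe, Fintype.range_linearCombination, hexact]
    fun u => Subtype.ext_iff.trans (h u)
  surjective_aug := by
    rintro ⟨g, hg⟩
    rw [hI] at hg
    obtain ⟨c, hc⟩ := Ideal.mem_span_range_iff_exists_fun.1 hg
    exact ⟨c, Subtype.ext hc⟩
  minimal
    | 0 =>
      have h (v : Fin n → MvPolynomial (Fin k) K) (j : Fin m) :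
          Fintype.linearCombination (MvPolynomial (Fin k) K) z v j ∈
            Ideal.span (Set.range (X : Fin k → MvPolynomial (Fin k) K)) := by
        rw [Fintype.linearCombination_apply, Finset.sum_apply]
        exact Ideal.sum_mem _ fun i _ => Ideal.mul_mem_left _ _ (hmin i j)
      h
    | _ + 1 => fun v j => Ideal.zero_mem _

/-- The syzygies of a pair of elements without common factor are generated by the Koszul one. -/
lemma mem_span_koszul_iff {R : Type*} [CommRing R] [IsDomain R] {f g : R} (hf : f ≠ 0)
    (hfg : ∀ w, f ∣ g * w → f ∣ w) (u : Fin 2 → R) :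
    ∑ i, u i * ![g, f] i = 0 ↔ u ∈ Submodule.span R (Set.range ![![f, -g]]) := by
  rw [Matrix.range_cons, Matrix.range_empty, Set.union_empty, Submodule.mem_span_singleton,
    Fin.sum_univ_two]
  simp only [Matrix.cons_val_zero, Matrix.cons_val_one]
  constructor
  · intro h
    obtain ⟨w, hw⟩ := hfg (u 0) ⟨-u 1, by linear_combination h⟩
    refine ⟨w, funext fun i => ?_⟩
    fin_cases i
    · simp [hw, mul_comm]
    · refine mul_left_cancel₀ hf ?_
      simp only [Fin.mk_one, Pi.smul_apply, Matrix.cons_val_one, Matrix.cons_val_fin_one,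
        smul_eq_mul]
      linear_combination g * hw - h
  · rintro ⟨w, rfl⟩
    simp only [Pi.smul_apply, Matrix.cons_val_zero, Matrix.cons_val_one, smul_eq_mul,
      Matrix.cons_val_fin_one]
    ring

/-- The Hilbert–Burch theorem for a matrix with two columns. -/
lemma mem_span_hilbertBurch_iff {R : Type*} [CommRing R] [IsDomain R] {a₀ b₀ c₀ a₁ b₁ c₁ : R}
    (h₀ : c₀ * a₁ - a₀ * c₁ ≠ 0)
    (h : ∀ w, c₀ * a₁ - a₀ * c₁ ∣ (c₀ * b₁ - b₀ * c₁) * w → c₀ * a₁ - a₀ * c₁ ∣ w)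
    (u : Fin 3 → R) :
    ∑ i, u i * ![c₀ * b₁ - b₀ * c₁, c₀ * a₁ - a₀ * c₁, a₀ * b₁ - b₀ * a₁] i = 0 ↔
      u ∈ Submodule.span R (Set.range ![![a₀, -b₀, -c₀], ![a₁, -b₁, -c₁]]) := by
  rw [Matrix.range_cons, Matrix.range_cons, Matrix.range_empty, Set.union_empty,
    Set.singleton_union, Submodule.mem_span_pair, Fin.sum_univ_three]
  simp only [Matrix.cons_val]
  constructor
  · intro hu
    -- Cramer's rule on the outer coordinates: the numerators are divisible by the middle minor
    -- because the relation `hu`, times `c₁` or `c₀`, shows this after multiplication by the first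
    -- minor.
    obtain ⟨w₀, hw₀⟩ := h (-(c₁ * u 0 + a₁ * u 2)) ⟨u 1 * c₁ - b₁ * u 2, by
      linear_combination -c₁ * hu⟩
    obtain ⟨w₁, hw₁⟩ := h (a₀ * u 2 + c₀ * u 0) ⟨b₀ * u 2 - c₀ * u 1, by
      linear_combination c₀ * hu⟩
    refine ⟨w₀, w₁, funext fun i => mul_left_cancel₀ h₀ ?_⟩
    fin_cases i <;> simp [-mul_eq_mul_left_iff]
    · linear_combination -a₀ * hw₀ - a₁ * hw₁
    · linear_combination b₀ * hw₀ + b₁ * hw₁ - hu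
    · linear_combination c₀ * hw₀ + c₁ * hw₁
  · rintro ⟨w₀, w₁, rfl⟩
    simp
    ring

lemma linearIndependent_hilbertBurch {R : Type*} [CommRing R] [IsDomain R]
    {a₀ b₀ c₀ a₁ b₁ c₁ : R} (h₀ : c₀ * a₁ - a₀ * c₁ ≠ 0) :
    LinearIndependent R ![![a₀, -b₀, -c₀], ![a₁, -b₁, -c₁]] := by
  rw [LinearIndependent.pair_iff]
  intro s t hst
  have h0 := congrFun hst 0
  have h2 := congrFun hst 2
  simp at h0 h2
  constructor <;> refine (mul_eq_zero_iff_left h₀).1 ?_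
  · linear_combination -c₁ * h0 - a₁ * h2
  · linear_combination c₀ * h0 + a₀ * h2

/-! ### Binomial kernels and the prime homogeneous binomial -/

/-- The kernel of an algebra map sending monomials to elements of a basis is generated by
binomials. -/
lemma ker_le_of_forall_monomial_sub_mem {K σ Γ S : Type*} [Field K] [CommRing S] [Algebra K S]
    (φ : MvPolynomial σ K →ₐ[K] S) (B : Module.Basis Γ K S) (deg : (σ →₀ ℕ) → Γ)
    (hφ : ∀ u, φ (monomial u 1) = B (deg u)) {J : Ideal (MvPolynomial σ K)}
    (hJ : ∀ u v, deg u = deg v → monomial u 1 - monomial v 1 ∈ J) : RingHom.ker φ ≤ J := by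
  -- Each basis vector goes to the class of a chosen monomial of that degree. Modulo `J` the choice
  -- is immaterial, so the quotient map factors through `φ`.
  let θ : S →ₗ[K] MvPolynomial σ K ⧸ J :=
    B.constr K fun d => Ideal.Quotient.mk J (monomial (Function.invFun deg d) 1)
  have hθ : θ ∘ₗ φ.toLinearMap = (Ideal.Quotient.mkₐ K J).toLinearMap := by
    refine (basisMonomials σ K).ext fun u => ?_
    simp only [coe_basisMonomials, LinearMap.comp_apply, AlgHom.toLinearMap_apply, hφ, θ,
      Module.Basis.constr_basis, Ideal.Quotient.mkₐ_eq_mk]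
    exact Ideal.Quotient.eq.2 (hJ _ _ (Function.invFun_eq ⟨u, rfl⟩))
  intro g hg
  have := LinearMap.congr_fun hθ g
  simp only [LinearMap.comp_apply, AlgHom.toLinearMap_apply, RingHom.mem_ker.1 hg, map_zero,
    Ideal.Quotient.mkₐ_eq_mk] at this
  exact Ideal.Quotient.eq_zero_iff_mem.1 this.symm

lemma monomial_fin_three {K : Type*} [CommSemiring K] (u : Fin 3 →₀ ℕ) :
    (monomial u 1 : MvPolynomial (Fin 3) K) = X 0 ^ u 0 * X 1 ^ u 1 * X 2 ^ u 2 := by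
  rw [monomial_eq, Finsupp.prod_fintype _ _ (fun _ => pow_zero _), Fin.prod_univ_three, C_1,
    one_mul]

section Binomial

variable {K : Type*} [Field K]

/-- The parametrization of the toric surface `x₁ ^ (α + γ) = x₀ ^ α * x₂ ^ γ`. -/
noncomputable def toricSurfaceMap (K : Type*) [Field K] (α γ : ℕ) :
    MvPolynomial (Fin 3) K →ₐ[K] MvPolynomial (Fin 2) K :=
  aeval ![X 0 ^ (α + γ), X 0 ^ α * X 1 ^ γ, X 1 ^ (α + γ)]

lemma toricSurfaceMap_monomial (α γ : ℕ) (u : Fin 3 →₀ ℕ) :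
    toricSurfaceMap K α γ (monomial u 1) = monomial (Finsupp.single 0 ((α + γ) * u 0 + α * u 1) +
      Finsupp.single 1 ((α + γ) * u 2 + γ * u 1)) 1 := by
  rw [MvPolynomial.monomial_fin_two, monomial_fin_three, toricSurfaceMap]
  simp
  ring

/-- Coprimality forces the `x₁`-exponents to differ by a multiple `(α + γ) k`, so the difference is
a monomial multiple of `A ^ k - B ^ k`, up to sign, with `A - B` the generator. -/
lemma monomial_sub_monomial_mem_span_binomial {α γ : ℕ} (hα : 0 < α) (h : Nat.Coprime α γ)
    {u v : Fin 3 →₀ ℕ} (h₀ : (α + γ) * u 0 + α * u 1 = (α + γ) * v 0 + α * v 1)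
    (h₂ : (α + γ) * u 2 + γ * u 1 = (α + γ) * v 2 + γ * v 1) :
    (monomial u 1 - monomial v 1 : MvPolynomial (Fin 3) K) ∈
      Ideal.span {(X 1 ^ (α + γ) - X 0 ^ α * X 2 ^ γ : MvPolynomial (Fin 3) K)} := by
  wlog huv : u 1 ≤ v 1 generalizing u v
  · rw [← neg_sub (monomial v 1)]
    exact neg_mem (this h₀.symm h₂.symm (le_of_not_ge huv))
  obtain ⟨d, hd⟩ := Nat.exists_eq_add_of_le huv
  rw [hd] at h₀ h₂
  have hcop : Nat.Coprime (α + γ) α := by simpa [Nat.coprime_comm] using h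
  obtain ⟨k, rfl⟩ : α + γ ∣ d := by
    refine hcop.dvd_of_dvd_mul_left (m := α) ?_
    refine (Nat.dvd_add_right (Dvd.intro (v 0) rfl)).1 (⟨u 0, ?_⟩ : _ ∣ (α + γ) * v 0 + α * d)
    linarith
  have hu₀ : u 0 = v 0 + α * k :=
    Nat.eq_of_mul_eq_mul_left (by omega : 0 < α + γ) (by linarith)
  have hu₂ : u 2 = v 2 + γ * k :=
    Nat.eq_of_mul_eq_mul_left (by omega : 0 < α + γ) (by linarith)
  rw [Ideal.mem_span_singleton, monomial_fin_three, monomial_fin_three, hd, hu₀, hu₂]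
  have hk := (sub_dvd_pow_sub_pow (X 1 ^ (α + γ) : MvPolynomial (Fin 3) K)
    (X 0 ^ α * X 2 ^ γ) k).mul_left (-(X 0 ^ v 0 * X 1 ^ u 1 * X 2 ^ v 2))
  convert hk using 1
  ring

lemma ker_toricSurfaceMap {α γ : ℕ} (hα : 0 < α) (h : Nat.Coprime α γ) :
    RingHom.ker (toricSurfaceMap K α γ) =
      Ideal.span {(X 1 ^ (α + γ) - X 0 ^ α * X 2 ^ γ : MvPolynomial (Fin 3) K)} := by
  refine le_antisymm (ker_le_of_forall_monomial_sub_mem _ (basisMonomials (Fin 2) K) _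
    (fun u => by rw [coe_basisMonomials]; exact toricSurfaceMap_monomial α γ u)
    fun u v huv => monomial_sub_monomial_mem_span_binomial hα h ?_ ?_) ?_
  · simpa using DFunLike.congr_fun huv 0
  · simpa using DFunLike.congr_fun huv 1
  · rw [Ideal.span_singleton_le_iff_mem, RingHom.mem_ker, toricSurfaceMap]
    simp
    ring

lemma binomial_ne_zero (α : ℕ) {γ : ℕ} (hγ : 0 < γ) :
    (X 1 ^ (α + γ) - X 0 ^ α * X 2 ^ γ : MvPolynomial (Fin 3) K) ≠ 0 := fun h => by
  simpa [hγ.ne'] using congrArg (eval ![(0 : K), 1, 0]) h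

lemma prime_binomial {α γ : ℕ} (hα : 0 < α) (hγ : 0 < γ) (h : Nat.Coprime α γ) :
    Prime (X 1 ^ (α + γ) - X 0 ^ α * X 2 ^ γ : MvPolynomial (Fin 3) K) := by
  rw [← Ideal.span_singleton_prime (binomial_ne_zero α hγ), ← ker_toricSurfaceMap hα h]
  exact RingHom.ker_isPrime _

lemma binomial_dvd_of_dvd_mul {α γ p q m : ℕ} (hα : 0 < α) (hγ : 0 < γ) (h : Nat.Coprime α γ)
    (hq : 0 < q) (w : MvPolynomial (Fin 3) K)
    (hw : (X 1 ^ (α + γ) - X 0 ^ α * X 2 ^ γ : MvPolynomial (Fin 3) K) ∣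
      (X 1 ^ p * X 2 ^ q - X 0 ^ m) * w) :
    (X 1 ^ (α + γ) - X 0 ^ α * X 2 ^ γ : MvPolynomial (Fin 3) K) ∣ w := by
  refine ((prime_binomial hα hγ h).dvd_or_dvd hw).resolve_left ?_
  rintro ⟨g, hg⟩
  -- At `(1, 0, 0)` the prime binomial vanishes, while the other binomial equals `-1`.
  simpa [hq.ne', hγ.ne'] using congrArg (eval ![(1 : K), 0, 0]) hg

end Binomial

/-! ### Generators of the curve ideal via reduced monomials -/

section Curve

variable {K : Type*} [Field K]

lemma aeval_X_pow_monomial (e : Fin 3 → ℕ) (u : Fin 3 →₀ ℕ) :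
    (aeval (fun i => (Polynomial.X : Polynomial K) ^ e i) :
      MvPolynomial (Fin 3) K →ₐ[K] Polynomial K) (monomial u 1) =
    Polynomial.X ^ (e 0 * u 0 + e 1 * u 1 + e 2 * u 2) := by
  rw [monomial_fin_three]
  simp only [map_mul, map_pow, aeval_X, ← pow_mul, ← pow_add]

/-- Each of the three rewritings preserves the weighted degree and strictly raises the exponent of
`x₀`, which the degree bounds; hence the process stops. -/
lemma exists_reduced_monomial {J : Ideal (MvPolynomial (Fin 3) K)} {n₀ n₁ n₂ α γ t p p' q : ℕ}
    (hn₀ : 0 < n₀) (hα : 0 < α) (ht : 0 < t)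
    (h₀ : p * n₁ + q * n₂ = (α + t) * n₀) (h₁ : (p + p') * n₁ = α * n₀ + γ * n₂)
    (hJ₀ : X 1 ^ p * X 2 ^ q - X 0 ^ (α + t) ∈ J)
    (hJ₁ : X 1 ^ (p + p') - X 0 ^ α * X 2 ^ γ ∈ J)
    (hJ₂ : X 2 ^ (q + γ) - X 0 ^ t * X 1 ^ p' ∈ J) (x y z : ℕ) :
    ∃ x' y' z', y' < p + p' ∧ z' < q + γ ∧ ¬ (p ≤ y' ∧ q ≤ z') ∧
      n₀ * x' + n₁ * y' + n₂ * z' = n₀ * x + n₁ * y + n₂ * z ∧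
      X 0 ^ x * X 1 ^ y * X 2 ^ z - X 0 ^ x' * X 1 ^ y' * X 2 ^ z' ∈ J := by
  have key (x₁ y₁ z₁ : ℕ) (hx : x < x₁)
      (hdeg : n₀ * x₁ + n₁ * y₁ + n₂ * z₁ = n₀ * x + n₁ * y + n₂ * z)
      (hmem : X 0 ^ x * X 1 ^ y * X 2 ^ z - X 0 ^ x₁ * X 1 ^ y₁ * X 2 ^ z₁ ∈ J) :
      ∃ x' y' z', y' < p + p' ∧ z' < q + γ ∧ ¬ (p ≤ y' ∧ q ≤ z') ∧
        n₀ * x' + n₁ * y' + n₂ * z' = n₀ * x + n₁ * y + n₂ * z ∧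
        X 0 ^ x * X 1 ^ y * X 2 ^ z - X 0 ^ x' * X 1 ^ y' * X 2 ^ z' ∈ J := by
    have hle : x₁ ≤ n₀ * x₁ := Nat.le_mul_of_pos_left _ hn₀
    have : n₀ * x + n₁ * y + n₂ * z - x₁ < n₀ * x + n₁ * y + n₂ * z - x := by omega
    obtain ⟨x', y', z', hy', hz', hyz', hdeg', hmem'⟩ :=
      exists_reduced_monomial hn₀ hα ht h₀ h₁ hJ₀ hJ₁ hJ₂ x₁ y₁ z₁
    refine ⟨x', y', z', hy', hz', hyz', hdeg'.trans hdeg, ?_⟩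
    simpa using add_mem hmem hmem'
  by_cases hy : p + p' ≤ y
  · obtain ⟨y, rfl⟩ := Nat.exists_eq_add_of_le hy
    refine key (x + α) y (z + γ) (by omega) (by linear_combination -h₁) ?_
    convert J.mul_mem_left (X 0 ^ x * X 1 ^ y * X 2 ^ z) hJ₁ using 1
    ring
  by_cases hz : q + γ ≤ z
  · obtain ⟨z, rfl⟩ := Nat.exists_eq_add_of_le hz
    refine key (x + t) (y + p') z (by omega) (by linear_combination h₁ - h₀) ?_
    convert J.mul_mem_left (X 0 ^ x * X 1 ^ y * X 2 ^ z) hJ₂ using 1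
    ring
  by_cases hyz : p ≤ y ∧ q ≤ z
  · obtain ⟨y, rfl⟩ := Nat.exists_eq_add_of_le hyz.1
    obtain ⟨z, rfl⟩ := Nat.exists_eq_add_of_le hyz.2
    refine key (x + (α + t)) y z (by omega) (by linear_combination -h₀) ?_
    convert J.mul_mem_left (X 0 ^ x * X 1 ^ y * X 2 ^ z) hJ₀ using 1
    ring
  exact ⟨x, y, z, by omega, by omega, hyz, rfl, by simp⟩
termination_by n₀ * x + n₁ * y + n₂ * z - x
decreasing_by simp only [*]

/-- Exponents of reduced monomials lying in the same class modulo the lattice spanned by `(p, q)`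
and `(p + p', -γ)` coincide. -/
lemma reduced_exponents_unique {γ p p' q y z y' z' : ℕ} {k l : ℤ}
    (hy : y < p + p') (hz : z < q + γ) (hyz : ¬ (p ≤ y ∧ q ≤ z))
    (hy' : y' < p + p') (hz' : z' < q + γ) (hyz' : ¬ (p ≤ y' ∧ q ≤ z'))
    (hk : (y' : ℤ) - y = k * p + l * (p + p')) (hl : (z' : ℤ) - z = k * q - l * γ) :
    y = y' ∧ z = z' := by
  -- The two points play symmetric roles. For `k ≥ 0`, each nonzero `(k, l)` moves a point out of
  -- the L-shaped region.
  wlog hk0 : 0 ≤ k generalizing y z y' z' k l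
  · obtain ⟨h, h'⟩ := this hy' hz' hyz' hy hz hyz (k := -k) (l := -l) (by linarith)
      (by linarith) (by omega)
    exact ⟨h.symm, h'.symm⟩
  rcases lt_trichotomy l 0 with hl0 | rfl | hl0
  · rcases hk0.eq_or_lt with rfl | hk1
    · nlinarith
    · nlinarith
  · rcases hk0.eq_or_lt with rfl | hk1
    · omega
    · refine absurd ⟨?_, ?_⟩ hyz'
      · zify; nlinarith
      · zify; nlinarith
  · nlinarith

end Curve

/-- Two monomials of equal degree reduce to monomials of equal degree. By `hΛ` their `(y,
z)`-exponents agree modulo a lattice, so the reduced monomials coincide. -/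
lemma monomialCurveIdeal_eq_span {K : Type u} [Field K] {n₀ n₁ n₂ α γ t p p' q : ℕ}
    (hn₀ : 0 < n₀) (hα : 0 < α) (ht : 0 < t)
    (h₀ : p * n₁ + q * n₂ = (α + t) * n₀) (h₁ : (p + p') * n₁ = α * n₀ + γ * n₂)
    (hΛ : ∀ x y z : ℤ, n₀ * x + n₁ * y + n₂ * z = 0 →
      ∃ k l : ℤ, y = k * p + l * (p + p') ∧ z = k * q - l * γ) :
    monomialCurveIdeal K ![n₀, n₁, n₂] = Ideal.span
      {X 1 ^ p * X 2 ^ q - X 0 ^ (α + t), X 1 ^ (p + p') - X 0 ^ α * X 2 ^ γ,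
        X 2 ^ (q + γ) - X 0 ^ t * X 1 ^ p'} := by
  refine le_antisymm (ker_le_of_forall_monomial_sub_mem _ (Polynomial.basisMonomials K)
    (fun u => n₀ * u 0 + n₁ * u 1 + n₂ * u 2) (fun u => ?_) fun u v huv => ?_) ?_
  · rw [Polynomial.coe_basisMonomials]
    exact (aeval_X_pow_monomial _ u).trans (Polynomial.X_pow_eq_monomial _)
  · rw [monomial_fin_three, monomial_fin_three]
    set J : Ideal (MvPolynomial (Fin 3) K) := Ideal.span
      {X 1 ^ p * X 2 ^ q - X 0 ^ (α + t), X 1 ^ (p + p') - X 0 ^ α * X 2 ^ γ,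
        X 2 ^ (q + γ) - X 0 ^ t * X 1 ^ p'} with hJ
    have hred := exists_reduced_monomial (J := J) hn₀ hα ht h₀ h₁
      (Ideal.subset_span (by simp)) (Ideal.subset_span (by simp)) (Ideal.subset_span (by simp))
    obtain ⟨x, y, z, hy, hz, hyz, hdeg, hmem⟩ := hred (u 0) (u 1) (u 2)
    obtain ⟨x', y', z', hy', hz', hyz', hdeg', hmem'⟩ := hred (v 0) (v 1) (v 2)
    have hxyz : n₀ * x + n₁ * y + n₂ * z = n₀ * x' + n₁ * y' + n₂ * z' := by
      rw [hdeg, hdeg']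
      exact huv
    obtain ⟨k, l, hk, hl⟩ := hΛ (x' - x) (y' - y) (z' - z) (by
      have : (n₀ * x + n₁ * y + n₂ * z : ℤ) = n₀ * x' + n₁ * y' + n₂ * z' := mod_cast hxyz
      linear_combination -this)
    obtain ⟨rfl, rfl⟩ := reduced_exponents_unique hy hz hyz hy' hz' hyz' hk hl
    obtain rfl : x = x' := Nat.eq_of_mul_eq_mul_left hn₀ (by omega)
    simpa using sub_mem hmem hmem'
  · have h₂ : n₂ * (q + γ) = n₀ * t + n₁ * p' := by linarith
    rw [Ideal.span_le]
    rintro g (rfl | rfl | rfl)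
    all_goals
      simp only [SetLike.mem_coe, monomialCurveIdeal, RingHom.mem_ker, map_sub, map_mul, map_pow,
        aeval_X, ← pow_mul, ← pow_add, Matrix.cons_val, sub_eq_zero]
      refine congrArg (Polynomial.X ^ ·) ?_
      linarith

/-! ### Minimal resolutions of the curve ideal -/

lemma X_pow_mem_span_range_X {K : Type u} [Field K] {n m : ℕ} (i : Fin n) (hm : 0 < m) :
    (X i ^ m : MvPolynomial (Fin n) K) ∈
      Ideal.span (Set.range (X : Fin n → MvPolynomial (Fin n) K)) :=
  Ideal.pow_mem_of_mem _ (Ideal.subset_span (Set.mem_range_self i)) _ hm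

/-- The case in which the monomial curve is a complete intersection. -/
lemma nonempty_resolution_of_completeIntersection {K : Type u} [Field K]
    {n₀ n₁ n₂ α γ t q : ℕ} (hn₀ : 0 < n₀) (hα : 0 < α) (hγ : 0 < γ) (ht : 0 < t) (hq : 0 < q)
    (hαγ : Nat.Coprime α γ)
    (h₀ : q * n₂ = (α + t) * n₀) (h₁ : (α + γ) * n₁ = α * n₀ + γ * n₂)
    (hΛ : ∀ x y z : ℤ, n₀ * x + n₁ * y + n₂ * z = 0 →
      ∃ k l : ℤ, y = l * (α + γ) ∧ z = k * q - l * γ) :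
    Nonempty (MinimalFreeResolution K 3 (twoStepRank 2 1)
      (monomialCurveIdeal K ![n₀, n₁, n₂])) := by
  have hI := monomialCurveIdeal_eq_span (K := K) (p := 0) (p' := α + γ) hn₀ hα ht
    (by simpa using h₀) (by simpa using h₁) (by simpa using hΛ)
  refine ⟨.ofSyzygies ![X 2 ^ q - X 0 ^ (α + t), X 1 ^ (α + γ) - X 0 ^ α * X 2 ^ γ]
    ![![X 1 ^ (α + γ) - X 0 ^ α * X 2 ^ γ, -(X 2 ^ q - X 0 ^ (α + t))]] ?_ ?_
    (mem_span_koszul_iff (binomial_ne_zero α hγ) fun w hw =>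
      binomial_dvd_of_dvd_mul (p := 0) hα hγ hαγ hq w (by simpa using hw)) ?_⟩
  · rw [hI]
    simp only [Matrix.range_cons, Matrix.range_empty, Set.union_empty, Set.singleton_union,
      pow_zero, one_mul, zero_add]
    refine le_antisymm (Ideal.span_le.2 ?_) (Ideal.span_mono ?_)
    · rintro g (rfl | rfl | rfl)
      · exact Ideal.subset_span (by simp)
      · exact Ideal.subset_span (by simp)
      -- For `p = 0` the third generator is a combination of the first two.
      · refine Ideal.mem_span_pair.2 ⟨X 2 ^ γ, -X 0 ^ t, ?_⟩
        ring
    · rintro g (rfl | rfl) <;> simp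
  · rw [linearIndependent_unique_iff]
    exact fun h => binomial_ne_zero (K := K) α hγ (congrFun h 0)
  · have hf : (X 1 ^ (α + γ) - X 0 ^ α * X 2 ^ γ : MvPolynomial (Fin 3) K) ∈
        Ideal.span (Set.range (X : Fin 3 → MvPolynomial (Fin 3) K)) :=
      sub_mem (X_pow_mem_span_range_X 1 (by omega))
        (Ideal.mul_mem_left _ _ (X_pow_mem_span_range_X 2 hγ))
    have hg : (-(X 2 ^ q - X 0 ^ (α + t)) : MvPolynomial (Fin 3) K) ∈
        Ideal.span (Set.range (X : Fin 3 → MvPolynomial (Fin 3) K)) :=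
      neg_mem (sub_mem (X_pow_mem_span_range_X 2 hq) (X_pow_mem_span_range_X 0 (by omega)))
    intro i j
    fin_cases i; fin_cases j
    · exact hf
    · exact hg

/-- The case in which the monomial curve is determinantal but not a complete intersection. -/
lemma nonempty_resolution_of_determinantal {K : Type u} [Field K]
    {n₀ n₁ n₂ α γ t p p' q : ℕ} (hn₀ : 0 < n₀) (hα : 0 < α) (hγ : 0 < γ) (ht : 0 < t)
    (hp : 0 < p) (hp' : 0 < p') (hq : 0 < q) (hαγ : Nat.Coprime α γ) (hpp' : p + p' = α + γ)
    (h₀ : p * n₁ + q * n₂ = (α + t) * n₀) (h₁ : (p + p') * n₁ = α * n₀ + γ * n₂)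
    (hΛ : ∀ x y z : ℤ, n₀ * x + n₁ * y + n₂ * z = 0 →
      ∃ k l : ℤ, y = k * p + l * (p + p') ∧ z = k * q - l * γ) :
    Nonempty (MinimalFreeResolution K 3 (twoStepRank 3 2)
      (monomialCurveIdeal K ![n₀, n₁, n₂])) := by
  have hf₀ : (X 1 ^ p * X 2 ^ q - X 0 ^ t * X 0 ^ α : MvPolynomial (Fin 3) K) =
      X 1 ^ p * X 2 ^ q - X 0 ^ (α + t) := by ring
  have hf₁ : (X 1 ^ p * X 1 ^ p' - X 2 ^ γ * X 0 ^ α : MvPolynomial (Fin 3) K) =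
      X 1 ^ (α + γ) - X 0 ^ α * X 2 ^ γ := by rw [← hpp']; ring
  have hf₂ : (X 2 ^ γ * X 2 ^ q - X 0 ^ t * X 1 ^ p' : MvPolynomial (Fin 3) K) =
      X 2 ^ (q + γ) - X 0 ^ t * X 1 ^ p' := by ring
  have hne := binomial_ne_zero (K := K) α hγ
  rw [← hf₁] at hne
  refine ⟨.ofSyzygies _ _ ?_ (linearIndependent_hilbertBurch hne)
    (mem_span_hilbertBurch_iff (b₀ := X 0 ^ t) (b₁ := X 2 ^ q) hne fun w hw => ?_) ?_⟩
  · rw [monomialCurveIdeal_eq_span hn₀ hα ht h₀ h₁ hΛ, hf₀, hf₁, hf₂, hpp']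
    simp only [Matrix.range_cons, Matrix.range_empty, Set.union_empty, Set.singleton_union]
  · rw [hf₀, hf₁] at hw
    rw [hf₁]
    exact binomial_dvd_of_dvd_mul hα hγ hαγ hq w hw
  · intro i j
    fin_cases i <;> fin_cases j
    · exact X_pow_mem_span_range_X 2 hγ
    · exact neg_mem (X_pow_mem_span_range_X 0 ht)
    · exact neg_mem (X_pow_mem_span_range_X 1 hp)
    · exact X_pow_mem_span_range_X 1 hp'
    · exact neg_mem (X_pow_mem_span_range_X 2 hq)
    · exact neg_mem (X_pow_mem_span_range_X 0 hα)

/-! ### Arithmetic of the exponents and periodicity -/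

/-- The integral relations between `e * h`, `e * (h + s * γ)` and `e * (h + s * c)`. -/
lemma exists_lattice_coordinates {e s h γ c p q : ℤ} (he : e ≠ 0) (hs : s ≠ 0) (hc : c ≠ 0)
    (hcγ : IsCoprime c γ) (hsh : IsCoprime s h) (hh : h = p * γ + q * c) {x y z : ℤ}
    (hxyz : e * h * x + e * (h + s * γ) * y + e * (h + s * c) * z = 0) :
    ∃ k l : ℤ, y = k * p + l * c ∧ z = k * q - l * γ := by
  have h₁ : h * (x + y + z) + s * (γ * y + c * z) = 0 :=
    mul_left_cancel₀ he (by linear_combination hxyz)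
  obtain ⟨k, hk⟩ : s ∣ x + y + z :=
    hsh.dvd_of_dvd_mul_left ⟨-(γ * y + c * z), by linear_combination h₁⟩
  have h₂ : γ * y + c * z = -k * h :=
    mul_left_cancel₀ hs (by linear_combination h₁ - h * hk)
  obtain ⟨l, hl⟩ : c ∣ y - -k * p :=
    hcγ.dvd_of_dvd_mul_left ⟨-k * q - z, by linear_combination h₂ - k * hh⟩
  refine ⟨-k, l, by linear_combination hl, mul_left_cancel₀ hc ?_⟩
  linear_combination h₂ - γ * hl - k * hh

/-- The ranks see only whether `p = 0`. The exponent `t` is `s + p + q - α`, positive because `q ≥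
α`. -/
lemma nonempty_resolution_monomialCurveIdeal (K : Type u) [Field K] {e s h α γ p q : ℕ}
    (he : 0 < e) (hs : 0 < s) (hα : 0 < α) (hγ : 0 < γ) (hαγ : Nat.Coprime α γ)
    (hsh : Nat.Coprime s h) (hp : p < α + γ) (hq : α ≤ q) (hh : h = p * γ + q * (α + γ)) :
    Nonempty (MinimalFreeResolution K 3
      (if p = 0 then twoStepRank 2 1 else twoStepRank 3 2)
      (monomialCurveIdeal K ![e * h, e * (h + s * γ), e * (h + s * (α + γ))])) := by
  obtain ⟨p', hp'⟩ := Nat.exists_eq_add_of_lt hp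
  obtain ⟨r, rfl⟩ := Nat.exists_eq_add_of_le hq
  have hpos : 0 < h := by rw [hh]; positivity
  have hcop : IsCoprime ((α : ℤ) + γ) γ := by
    exact_mod_cast Nat.isCoprime_iff_coprime.2 (by simpa using hαγ : Nat.Coprime (α + γ) γ)
  have hh' : (h : ℤ) = p * γ + ((α + r : ℕ) : ℤ) * (α + γ) := mod_cast hh
  have hΛ (x y z : ℤ) (hxyz : ((e * h : ℕ) : ℤ) * x + ((e * (h + s * γ) : ℕ) : ℤ) * y +
      ((e * (h + s * (α + γ)) : ℕ) : ℤ) * z = 0) :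
      ∃ k l : ℤ, y = k * p + l * (α + γ) ∧ z = k * (α + r : ℕ) - l * γ :=
    exists_lattice_coordinates (e := e) (by positivity) (by positivity) (by positivity) hcop
      (Nat.isCoprime_iff_coprime.2 hsh) hh' (by push_cast at hxyz; exact hxyz)
  split_ifs with hp0
  · subst hp0
    refine nonempty_resolution_of_completeIntersection (t := s + r) (q := α + r) (by positivity)
      hα hγ (by omega) (by omega) hαγ ?_ ?_ (by simpa using hΛ)
    · linear_combination e * s * hh.symm
    · ring
  · refine nonempty_resolution_of_determinantal (t := s + p + r) (p := p) (p' := p' + 1)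
      (q := α + r) (by positivity) hα hγ
      (by omega) (by omega) (by omega) (by omega) hαγ (by omega) ?_ ?_ ?_
    · linear_combination e * s * hh.symm
    · linear_combination e * (h + s * γ) * hp'.symm
    · intro x y z hxyz
      have : (p : ℤ) + (p' + 1 : ℕ) = α + γ := by omega
      rw [this]
      exact hΛ x y z hxyz

/-- Numerical data attached to `(j, j + a, j + b)` for large `j`. -/
lemma exists_curve_parameters {a b j : ℕ} (ha : 0 < a) (hab : a < b) (hj : 2 * b ^ 3 ≤ j) :
    ∃ e s h α γ p q : ℕ, 0 < e ∧ 0 < s ∧ 0 < α ∧ 0 < γ ∧ Nat.Coprime α γ ∧ Nat.Coprime s h ∧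
      p < α + γ ∧ α ≤ q ∧ h = p * γ + q * (α + γ) ∧ a = e * (s * γ) ∧ b = e * (s * (α + γ)) ∧
      j = e * h := by
  have hg : 0 < Nat.gcd a b := Nat.gcd_pos_of_pos_left _ ha
  obtain ⟨γ, c, hγc, ha', hb'⟩ := Nat.exists_coprime a b
  obtain ⟨s, h, hsh, hs', hj'⟩ := Nat.exists_coprime (Nat.gcd a b) j
  set g := Nat.gcd a b
  set e := Nat.gcd g j
  have he : 0 < e := Nat.gcd_pos_of_pos_left _ hg
  have hs : 0 < s := Nat.pos_of_ne_zero (by rintro rfl; omega)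
  have hγ : 0 < γ := Nat.pos_of_ne_zero (by rintro rfl; omega)
  have hlt : γ < c := lt_of_mul_lt_mul_right (by rw [← ha', ← hb']; exact hab) (Nat.zero_le g)
  obtain ⟨α, rfl⟩ := Nat.exists_eq_add_of_lt hlt
  set c := γ + α + 1 with hc
  have hcb : c ≤ b := by rw [hb']; exact Nat.le_mul_of_pos_right _ hg
  have heb : e ≤ b := (Nat.le_of_dvd hg (Nat.gcd_dvd_left _ _)).trans
    (Nat.le_of_dvd (by omega) (Nat.gcd_dvd_right _ _))
  -- The threshold `2 * b ^ 3` allows for `e ≤ b`. Since `p γ ≤ b ^ 2` and `c ≤ b`, the bound on `h`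
  -- forces `q ≥ b`, hence `q ≥ α`.
  have hh : 2 * b ^ 2 ≤ h := by
    refine le_of_mul_le_mul_left (?_ : b * (2 * b ^ 2) ≤ b * h) (by omega)
    calc b * (2 * b ^ 2) = 2 * b ^ 3 := by ring
      _ ≤ h * e := hj.trans hj'.le
      _ ≤ b * h := by rw [mul_comm]; exact Nat.mul_le_mul_right _ heb
  -- `p` is the residue of `h γ⁻¹` modulo `c`.
  obtain ⟨p, hp, hmod⟩ : ∃ p < c, p * γ ≡ h [MOD c] := by
    obtain ⟨m, hm⟩ := Nat.exists_mul_mod_eq_one_of_coprime hγc (by omega)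
    refine ⟨(m * h) % c, Nat.mod_lt _ (by omega), ?_⟩
    calc (m * h) % c * γ ≡ m * h * γ [MOD c] := (Nat.mod_modEq _ _).mul_right _
      _ = γ * m * h := by ring
      _ ≡ 1 * h [MOD c] := by
        refine Nat.ModEq.mul_right _ ?_
        rw [Nat.ModEq, hm.2, Nat.mod_eq_of_lt (by omega)]
      _ = h := one_mul h
  have hpγ : p * γ ≤ b ^ 2 := by nlinarith
  obtain ⟨q, hq⟩ := (Nat.modEq_iff_dvd' (by nlinarith)).1 hmod
  have hhq : h = p * γ + q * c := by
    rw [mul_comm q, ← hq]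
    have : p * γ ≤ h := by nlinarith
    omega
  refine ⟨e, s, h, α + 1, γ, p, q, he, hs, by omega, hγ, ?_, hsh, by omega, ?_, ?_, ?_, ?_, ?_⟩
  · simpa [hc, add_assoc, Nat.coprime_comm] using hγc
  · have : b ≤ q := by
      by_contra hlt
      nlinarith
    omega
  · rw [hhq, hc]; ring
  · rw [ha', hs']; ring
  · rw [hb', hs', hc]; ring
  · rw [hj']; ring

theorem theorem1p4 (a b : ℕ) (ha : 0 < a) (hab : a < b) :
    ∃ N : ℕ, ∀ (K : Type u) [Field K] [CharZero K] (j : ℕ), N ≤ j → ∀ i : ℕ,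
      bettiNumber K 3 i (monomialCurveIdeal K ![j + b, (j + b) + a, (j + b) + b]) =
        bettiNumber K 3 i (monomialCurveIdeal K ![j, j + a, j + b]) := by
  refine ⟨2 * b ^ 3, fun K _ _ j hj i => ?_⟩
  obtain ⟨e, s, h, α, γ, p, q, he, hs, hα, hγ, hαγ, hsh, hp, hq, hh, rfl, rfl, rfl⟩ :=
    exists_curve_parameters ha hab hj
  obtain ⟨F⟩ := nonempty_resolution_monomialCurveIdeal K he hs hα hγ hαγ hsh hp hq hh
  -- Adding `b = e s (α + γ)` to `j` changes `h` to `h + s (α + γ)`, absorbed by `q + s` with the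
  -- same `p`.
  obtain ⟨F'⟩ := nonempty_resolution_monomialCurveIdeal K he hs hα hγ hαγ
    (h := h + s * (α + γ)) (q := q + s) (by simpa using hsh) hp (by omega) (by rw [hh]; ring)
  have hadd (m n : ℕ) : e * m + e * n = e * (m + n) := by ring
  rw [hadd, hadd, hadd, hadd]
  exact F'.bettiNumber_eq F i
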